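/- \textbf{Setting.} A state $\omega\in\{0,1\}$ and the signals $S_1,S_2\in\{L,H\}$ of two experts are drawn from a joint distribution $\pi$ (an information structure). At the signal $s_i$, expert $i$ recommends $a_i=\phi(\pi(\omega=1\mid S_i=s_i))$, where $\phi(b)=1$ if $b\ge 1/2$ and $\phi(b)=0$ otherwise, and predicts $p_i$, the conditional probability given $S_i=s_i$ that the other expert recommends action $1$. A random aggregator $f$ maps $(a_1,a_2,p_1,p_2)$ to the probability $f(a_1,a_2,p_1,p_2)\in[0,1]$ of taking action $1$; it uses no second-order information if it does not depend on $(p_1,p_2)$. With the benchmark $a^*=\phi(\pi(\omega=1\mid S_1=s_1,S_2=s_2))$, the loss of $f$ is $$L(f,\pi)=\mathbb E\left[\mathbb 1\{a^*=\omega\}-\mathbb 1\{f(a_1,a_2,p_1,p_2)=\omega\}\right],$$ the expectation being over $(\omega,s_1,s_2)\sim\pi$ and the randomness of the action, and the regret of $f$ over a family $P$ of information structures is $L_P(f)=\sup_{\pi\in P}L(f,\pi)$. Let $P$ be the family of all information structures such that $S_1,S_2$ are independent conditionally on $\omega$; the experts are homogeneous, i.e. for each $s\in\{L,H\}$ the probabilities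 $\pi(S_i=s\mid\omega)$ and the posteriors $b_s=\pi(\omega=1\mid S_i=s)$ do not depend on $i$; and the signals are non-degenerate, i.e. both signals have positive probability and $b_L<1/2\le b_H$. The bipolar radial aggregator $f^{\mathrm{br}}$ is given by $f^{\mathrm{br}}(1,1,p_1,p_2)=1$, $f^{\mathrm{br}}(0,0,p_1,p_2)=0$, $$f^{\mathrm{br}}(1,0,p_1,p_2)=\begin{cases}\min\{1,(p_1-0.6)^2+(p_2-0.4)^2+0.5\},&p_1+p_2<0.98,\\ \max\{0,0.5-(p_1-0.6)^2-(p_2-0.4)^2\},&p_1+p_2>1.02,\\ 0.5,&\text{otherwise,}\end{cases}$$ and $f^{\mathrm{br}}(0,1,p_1,p_2)=f^{\mathrm{br}}(1,0,p_2,p_1)$. \textbf{Theorem.} The regret of the bipolar radial aggregator over $P$ is attained as a maximum, $L_P(f^{\mathrm{br}})=\max_{\pi\in P}L(f^{\mathrm{br}},\pi)$, and it is $0.1682$ to four decimal places: $|L_P(f^{\mathrm{br}})-0.1682|\le 0.00005$. In particular $L_P(f^{\mathrm{br}})<3-2\sqrt2$, whereas every random aggregator $g$ without second-order information satisfies $L_P(g)\ge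 3-2\sqrt2$; hence second-order information strictly helps random aggregators over $P$. -/

import Mathlib

namespace DecisionAggregation

/-- The two private signals, `L` (low) and `H` (high). -/
inductive Signal where
  | L : Signal
  | H : Signal
  deriving DecidableEq

instance : Fintype Signal where
  elems := {Signal.L, Signal.H}
  complete := fun s => by cases s <;> decide

/-- Outcomes `(ω, s₁, s₂)`: the binary state of the world and the signals of the two experts. -/
abbrev Outcome : Type := Fin 2 × Signal × Signal

/-- An information structure: a joint probability distribution of the state and the two signals. -/
abbrev InfoStructure : Type := stdSimplex ℝ Outcome

/-- The state `ω`. -/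
def state (x : Outcome) : Fin 2 := x.1

/-- The signal of expert `i`; expert `0` is the first one, expert `1` the second one. -/
def signal (i : Fin 2) (x : Outcome) : Signal := if i = 0 then x.2.1 else x.2.2

/-- The other expert. -/
def other (i : Fin 2) : Fin 2 := 1 - i

noncomputable section

/-- Probability of the event `E`. -/
def prob (π : InfoStructure) (E : Outcome → Prop) [DecidablePred E] : ℝ :=
  ∑ x : Outcome, if E x then π.1 x else 0

/-- Conditional probability of `E` given `F`. -/
def condProb (π : InfoStructure) (E F : Outcome → Prop) [DecidablePred E] [DecidablePred F] : ℝ :=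
  prob π (fun x => E x ∧ F x) / prob π F

/-- The posterior probability of state `1` given that expert `i` sees the signal `s`. -/
def posterior (π : InfoStructure) (i : Fin 2) (s : Signal) : ℝ :=
  condProb π (fun x => state x = 1) (fun x => signal i x = s)

/-- The optimal action at belief `b`: action `1` if and only if `b ≥ 1/2`. -/
def phi (b : ℝ) : Fin 2 := if 1 / 2 ≤ b then 1 else 0

/-- The action recommended by expert `i` at the signal `s`. -/
def recommendation (π : InfoStructure) (i : Fin 2) (s : Signal) : Fin 2 := phi (posterior π i s)

/-- The prediction of expert `i` at the signal `s`: the conditional probability that the other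
expert recommends action `1`. -/
def prediction (π : InfoStructure) (i : Fin 2) (s : Signal) : ℝ :=
  condProb π (fun x => recommendation π (other i) (signal (other i) x) = 1)
    (fun x => signal i x = s)

/-- The action of the omniscient benchmark, which knows `π` and sees both signals. -/
def benchmark (π : InfoStructure) (s₁ s₂ : Signal) : Fin 2 :=
  phi (condProb π (fun x => state x = 1) (fun x => signal 0 x = s₁ ∧ signal 1 x = s₂))

/-- A random aggregator with second-order information: it maps `(a₁, a₂, p₁, p₂)` to a
distribution over actions, encoded by the probability of taking action `1`. -/
abbrev Aggregator : Type := Fin 2 → Fin 2 → ℝ → ℝ → unitInterval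

/-- A random aggregator without second-order information. -/
abbrev FirstOrderAggregator : Type := Fin 2 → Fin 2 → unitInterval

/-- A first-order aggregator as an aggregator that ignores the predictions. -/
def FirstOrderAggregator.toAggregator (g : FirstOrderAggregator) : Aggregator :=
  fun a₁ a₂ _ _ => g a₁ a₂

/-- The probability that a random action, equal to `1` with probability `q`, is equal to `ω`. -/
def matchProb (q : unitInterval) (ω : Fin 2) : ℝ := if ω = 1 then (q : ℝ) else 1 - (q : ℝ)

/-- The loss of `f` under `π`: the expectation of `𝟙{a* = ω} - 𝟙{f(a₁, a₂, p₁, p₂) = ω}`. -/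
def loss (f : Aggregator) (π : InfoStructure) : ℝ :=
  ∑ x : Outcome, π.1 x *
    ((if benchmark π (signal 0 x) (signal 1 x) = state x then 1 else 0) -
      matchProb
        (f (recommendation π 0 (signal 0 x)) (recommendation π 1 (signal 1 x))
          (prediction π 0 (signal 0 x)) (prediction π 1 (signal 1 x)))
        (state x))

/-- The regret of `f` over a family of information structures: the worst-case loss. -/
def regret (P : Set InfoStructure) (f : Aggregator) : ℝ := sSup (loss f '' P)

/-- The two signals are independent conditionally on the state. -/
def CondIndep (π : InfoStructure) : Prop :=
  ∀ (ω : Fin 2) (s₁ s₂ : Signal),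
    condProb π (fun x => signal 0 x = s₁ ∧ signal 1 x = s₂) (fun x => state x = ω) =
      condProb π (fun x => signal 0 x = s₁) (fun x => state x = ω) *
        condProb π (fun x => signal 1 x = s₂) (fun x => state x = ω)

/-- The two experts have the same signal probabilities given the state and the same posteriors. -/
def Homogeneous (π : InfoStructure) : Prop :=
  (∀ (s : Signal) (ω : Fin 2),
    condProb π (fun x => signal 0 x = s) (fun x => state x = ω) =
      condProb π (fun x => signal 1 x = s) (fun x => state x = ω)) ∧
  ∀ s : Signal, posterior π 0 s = posterior π 1 s

/-- Both signals of each expert occur, and `b_L < 1/2 ≤ b_H`: the expert recommends action `0` at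
`L` and action `1` at `H`. -/
def NonDegenerate (π : InfoStructure) : Prop :=
  ∀ i : Fin 2, (∀ s : Signal, 0 < prob π (fun x => signal i x = s)) ∧
    posterior π i Signal.L < 1 / 2 ∧ 1 / 2 ≤ posterior π i Signal.H

/-- The conditionally independent information structures with homogeneous experts and
non-degenerate signals. -/
def homogeneousNonDegenerateCI : Set InfoStructure :=
  {π | CondIndep π ∧ Homogeneous π ∧ NonDegenerate π}

/-- The probability of action `1` in the bipolar radial rule when the expert who recommends action
`1` predicts `p` and the expert who recommends action `0` predicts `q`. -/
def radialValue (p q : ℝ) : ℝ :=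
  if p + q < 0.98 then min 1 ((p - 0.6) ^ 2 + (q - 0.4) ^ 2 + 0.5)
  else if 1.02 < p + q then max 0 (0.5 - (p - 0.6) ^ 2 - (q - 0.4) ^ 2)
  else 0.5

theorem radialValue_mem (p q : ℝ) : radialValue p q ∈ unitInterval := by
  have h1 := sq_nonneg (p - 0.6)
  have h2 := sq_nonneg (q - 0.4)
  unfold radialValue
  split_ifs
  · exact ⟨le_min (by norm_num) (by linarith), min_le_left _ _⟩
  · exact ⟨le_max_left _ _, max_le (by norm_num) (by linarith)⟩
  · constructor <;> norm_num

/-- The bipolar radial aggregator: it follows the recommendation when the experts agree, and uses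
the radial rule, treating the two experts symmetrically, when they disagree. -/
def bipolarRadial : Aggregator := fun a₁ a₂ p₁ p₂ =>
  if a₁ = a₂ then (if a₁ = 1 then 1 else 0)
  else if a₁ = 1 then ⟨radialValue p₁ p₂, radialValue_mem p₁ p₂⟩
  else ⟨radialValue p₂ p₁, radialValue_mem p₂ p₁⟩

end

end DecisionAggregation

/-!
A structure of the family is determined by the prior `m` of state `1` and the probabilities `a`, `b`
of the signal `H` in the states `1` and `0` (`exists_ciStructure_eq`). When the experts agree the
benchmark agrees with them, so the bipolar radial rule loses only when they disagree. With
`x = m a (1 - a)` and `y = (1 - m) b (1 - b)`, the probabilities of the signals `(H, L)` together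
with state `1` and with state `0`, and `v` the value of the radial rule, the loss is
`2 (max x y - v x - (1 - v) y)`.

Exchanging the states and the signals exchanges `x` and `y` and replaces `v` by `1 - v`
(`radialValue_mirror`), so for the upper bound let `y ≤ x`; the loss is then `2 (1 - v) (x - y)`.
Let `h` be the probability of `H`. The predictions are `p = 1 - (x + y) / h` and
`q = (x + y) / (1 - h)`, and `b_L ≤ 1/2` gives `x ≤ h (1 - h) / (1 + h)`. Only these relations are
used, in `radial_loss_le`:

* for `p + q < 0.98` the loss is at most its value at `y = 0`, `x = h (1 - h) / (1 + h)`
  (`loss_le_of_sub`), a function of `h` alone whose maximum is slightly below `1274 / 7575`;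
* for `p + q > 1.02` the same reduction (`loss_le_of_add`) settles `h ≥ 17 / 33`, and for smaller
  `h` the condition on `p + q` itself bounds `x - y` (`sub_le_of_add_predictions`);
* in the band between, the loss is `x - y`, which is at most `1274 / 7575` with equality exactly when
  `y = 0`, `x = h (1 - h) / (1 + h)` and `p + q = 0.98` (`band_bound`).

So the worst case lies on the edge of the band. There `b_L = 1/2`, which the family excludes, but
the mirror image of this structure has `b_H = 1/2`, which it allows, and the maximum
`1274 / 7575 ≈ 0.16819` is attained (`exists_bipolarRadial_loss_eq`).

Without second-order information the weight `v` is constant, up to averaging over which expert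
recommends action `1`. Two mirror-image structures in which `max x y` is `3 - 2 √2` and the other
probability is `0`, one of them a limit of structures of the family, give losses
`2 (1 - v) (3 - 2 √2)` and `2 v (3 - 2 √2)`, and the larger of the two is at least `3 - 2 √2`
(`le_firstOrder_regret`).
-/

namespace DecisionAggregation

/-! ### Information structures of the family -/

theorem Signal.sum_eq (f : Signal → ℝ) : ∑ s, f s = f .L + f .H :=
  Finset.sum_pair (by decide)

theorem sum_outcome (f : Outcome → ℝ) :
    ∑ x, f x = f (0, .L, .L) + f (0, .L, .H) + f (0, .H, .L) + f (0, .H, .H) +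
      (f (1, .L, .L) + f (1, .L, .H) + f (1, .H, .L) + f (1, .H, .H)) := by
  simp only [Fintype.sum_prod_type, Fin.sum_univ_two, Signal.sum_eq]
  ring

theorem phi_eq_one {b : ℝ} (h : 1 / 2 ≤ b) : phi b = 1 := if_pos h

theorem phi_eq_zero {b : ℝ} (h : b < 1 / 2) : phi b = 0 := if_neg (not_le.2 h)

/-- The conditionally independent structure with prior `m` of state `1` in which both experts see
`H` with probability `a` in state `1` and with probability `b` in state `0`. -/
noncomputable def ciStructure (m a b : unitInterval) : InfoStructure :=
  ⟨fun x => (if x.1 = 1 then (m : ℝ) else 1 - m) *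
      (if x.2.1 = .H then (if x.1 = 1 then (a : ℝ) else b)
        else 1 - (if x.1 = 1 then (a : ℝ) else b)) *
      (if x.2.2 = .H then (if x.1 = 1 then (a : ℝ) else b)
        else 1 - (if x.1 = 1 then (a : ℝ) else b)), by
    have := m.2.1; have := m.2.2; have := a.2.1; have := a.2.2
    have := b.2.1; have := b.2.2
    constructor
    · intro x
      have h1 : (0 : ℝ) ≤ if x.1 = 1 then (m : ℝ) else 1 - m := by split_ifs <;> linarith
      have h2 : (0 : ℝ) ≤ if x.1 = 1 then (a : ℝ) else b := by split_ifs <;> linarith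
      have h3 : (if x.1 = 1 then (a : ℝ) else b) ≤ 1 := by split_ifs <;> linarith
      exact mul_nonneg (mul_nonneg h1 (by split_ifs <;> linarith)) (by split_ifs <;> linarith)
    · rw [sum_outcome]
      simp
      ring⟩


/-- The parameters for which `ciStructure m a b` is non-degenerate: the signal `H` has positive
probability, `b_H ≥ 1/2` and `b_L < 1/2`, all with denominators cleared. The last condition
already forces the signal `L` to have positive probability. -/
structure Admissible (m a b : unitInterval) : Prop where
  probH_pos : 0 < (m * a + (1 - m) * b : ℝ)
  high : ((1 - m) * b : ℝ) ≤ m * a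
  low : (m * (1 - a) : ℝ) < (1 - m) * (1 - b)

variable {m a b : unitInterval}

theorem Admissible.probL_pos (h : Admissible m a b) :
    0 < (m * (1 - a) + (1 - m) * (1 - b) : ℝ) := by
  have := mul_nonneg m.2.1 (sub_nonneg.2 a.2.2)
  linarith [h.low]

theorem Admissible.m_pos (h : Admissible m a b) : 0 < (m : ℝ) := by
  have := h.probH_pos
  have := h.high
  by_contra! hm
  nlinarith [m.2.1, a.2.1]

theorem Admissible.m_lt_one (h : Admissible m a b) : (m : ℝ) < 1 := by
  have := h.low
  by_contra! hm
  nlinarith [mul_nonneg m.2.1 (sub_nonneg.2 a.2.2), b.2.2]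

/-- The signal `H` is more likely in state `1` than in state `0`. -/
theorem Admissible.lt (h : Admissible m a b) : (b : ℝ) < a := by
  by_contra! hab
  have h1 := h.m_pos
  have h2 := h.m_lt_one
  have h3 := h.high
  have h4 := h.low
  have h5 := h.probH_pos
  have ha : (0 : ℝ) < a := by
    by_contra! ha
    nlinarith [a.2.1]
  have hb : (b : ℝ) < 1 := by
    by_contra! hb
    nlinarith [b.2.2, mul_nonneg m.2.1 (sub_nonneg.2 a.2.2)]
  -- compare the prior of the two states: `H` makes state `1` more likely, `L` state `0`
  have h6 : (1 - m : ℝ) ≤ m := le_of_mul_le_mul_right (by nlinarith : (1 - m : ℝ) * a ≤ m * a) ha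
  nlinarith

/-! ### Recommendations, predictions and the loss -/

theorem ciStructure_posterior_H (i : Fin 2) :
    posterior (ciStructure m a b) i .H = m * a / (m * a + (1 - m) * b) := by
  fin_cases i <;>
  simp [posterior, condProb, prob, sum_outcome, state, signal, ciStructure] <;>
  congr 1 <;> ring

theorem ciStructure_posterior_L (i : Fin 2) :
    posterior (ciStructure m a b) i .L = m * (1 - a) / (m * (1 - a) + (1 - m) * (1 - b)) := by
  fin_cases i <;>
  simp [posterior, condProb, prob, sum_outcome, state, signal, ciStructure] <;>
  congr 1 <;> ring

theorem Admissible.half_le_posterior_H (h : Admissible m a b) (i : Fin 2) :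
    1 / 2 ≤ posterior (ciStructure m a b) i .H := by
  rw [ciStructure_posterior_H, div_le_div_iff₀ two_pos h.probH_pos]
  linarith [h.high]

theorem Admissible.posterior_L_lt_half (h : Admissible m a b) (i : Fin 2) :
    posterior (ciStructure m a b) i .L < 1 / 2 := by
  rw [ciStructure_posterior_L, div_lt_div_iff₀ h.probL_pos two_pos]
  linarith [h.low]

theorem Admissible.mem (h : Admissible m a b) :
    ciStructure m a b ∈ homogeneousNonDegenerateCI := by
  have h1 := h.m_pos.ne'
  have h2 : (1 - m : ℝ) ≠ 0 := by linarith [h.m_lt_one]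
  have e2 : ∀ u v : ℝ, u * (1 - v) * (1 - v) + u * (1 - v) * v = u * (1 - v) :=
    fun u v => by ring
  have e3 : ∀ u v : ℝ, u * v * (1 - v) + u * v * v = u * v := fun u v => by ring
  have e4 : ∀ u v : ℝ, u * (1 - v) * (1 - v) + u * v * (1 - v) = u * (1 - v) :=
    fun u v => by ring
  have e5 : ∀ u v : ℝ, u * (1 - v) * v + u * v * v = u * v := fun u v => by ring
  have e6 : ∀ u v : ℝ, u * (1 - v) + u * v * (1 - v) + u * v * v = u := fun u v => by ring
  refine ⟨?_, ⟨?_, fun s => ?_⟩, fun i => ⟨fun s => ?_, h.posterior_L_lt_half i,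
    h.half_le_posterior_H i⟩⟩
  · intro ω s₁ s₂
    fin_cases ω <;> cases s₁ <;> cases s₂ <;>
    simp [condProb, prob, sum_outcome, state, signal, ciStructure, e2, e3, e4, e5, e6] <;>
    field_simp
  · intro s ω
    fin_cases ω <;> cases s <;>
    simp [condProb, prob, sum_outcome, state, signal, ciStructure, e2, e3, e4, e5, e6]
  · cases s
    · rw [ciStructure_posterior_L, ciStructure_posterior_L]
    · rw [ciStructure_posterior_H, ciStructure_posterior_H]
  · have hH := h.probH_pos
    have hL := h.probL_pos
    fin_cases i <;> cases s <;>
    simp [prob, sum_outcome, signal, ciStructure, e2, e3, e4, e5] <;> linarith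

/-- Within one state, the joint masses of the signals are determined by the total mass and the
probability of `H`. -/
theorem masses_eq {ll lh hl hh : ℝ} (hT : 0 < ll + lh + hl + hh)
    (hom : (hl + hh) / (ll + lh + hl + hh) = (lh + hh) / (ll + lh + hl + hh))
    (ind : hh / (ll + lh + hl + hh) =
      (hl + hh) / (ll + lh + hl + hh) * ((lh + hh) / (ll + lh + hl + hh)))
    {T c : ℝ} (eT : ll + lh + hl + hh = T) (ec : (hl + hh) / (ll + lh + hl + hh) = c) :
    hh = T * c * c ∧ hl = T * c * (1 - c) ∧ lh = T * (1 - c) * c ∧ ll = T * (1 - c) * (1 - c) := by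
  rw [← hom, eT] at ind
  rw [eT] at hom ec hT
  rw [ec, div_eq_iff hT.ne'] at ind
  have h1 : lh + hh = c * T := by rw [← ec, hom]; field_simp
  have h2 : hl + hh = c * T := by rw [← ec]; field_simp
  refine ⟨by linarith, by linarith, by linarith, by linarith⟩

/-- Every structure of the family is a `ciStructure`. -/
theorem exists_ciStructure_eq {π : InfoStructure} (hπ : π ∈ homogeneousNonDegenerateCI) :
    ∃ m a b, Admissible m a b ∧ π = ciStructure m a b := by
  obtain ⟨hci, ⟨hh, -⟩, hn⟩ := hπ
  obtain ⟨w, nn, tot⟩ := π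
  have f0 := hh .H 0
  have f1 := hh .H 1
  have nL := (hn 0).1 .L
  have nH := (hn 0).1 .H
  have pL := (hn 0).2.1
  have pH := (hn 0).2.2
  have c0 := hci 0 .H .H
  have c1 := hci 1 .H .H
  clear hci hh hn
  simp only [posterior, condProb, prob, sum_outcome, state, signal] at f0 f1 nL nH pL pH c0 c1 tot
  simp at f0 f1 nL nH pL pH c0 c1
  suffices h : ∃ m a b : unitInterval, Admissible m a b ∧
      (w (1, .H, .H) = m * a * a ∧ w (1, .H, .L) = m * a * (1 - a) ∧
        w (1, .L, .H) = m * (1 - a) * a ∧ w (1, .L, .L) = m * (1 - a) * (1 - a)) ∧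
      (w (0, .H, .H) = (1 - m) * b * b ∧ w (0, .H, .L) = (1 - m) * b * (1 - b) ∧
        w (0, .L, .H) = (1 - m) * (1 - b) * b ∧
        w (0, .L, .L) = (1 - m) * (1 - b) * (1 - b)) by
    obtain ⟨m, a, b, hab, ⟨r8, r7, r6, r5⟩, r4, r3, r2, r1⟩ := h
    refine ⟨m, a, b, hab, Subtype.ext ?_⟩
    funext ⟨ω, s, t⟩
    fin_cases ω <;> cases s <;> cases t <;> simp [ciStructure] <;> assumption
  have n1 := nn (0, .L, .L)
  have n2 := nn (0, .L, .H)
  have n3 := nn (0, .H, .L)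
  have n4 := nn (0, .H, .H)
  have n5 := nn (1, .L, .L)
  have n6 := nn (1, .L, .H)
  have n7 := nn (1, .H, .L)
  have n8 := nn (1, .H, .H)
  generalize w (0, .L, .L) = x1 at *
  generalize w (0, .L, .H) = x2 at *
  generalize w (0, .H, .L) = x3 at *
  generalize w (0, .H, .H) = x4 at *
  generalize w (1, .L, .L) = x5 at *
  generalize w (1, .L, .H) = x6 at *
  generalize w (1, .H, .L) = x7 at *
  generalize w (1, .H, .H) = x8 at *
  clear nn
  rw [div_lt_iff₀ nL] at pL
  rw [le_div_iff₀ nH] at pH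
  obtain ⟨m, em⟩ : ∃ m, x5 + x6 + x7 + x8 = m := ⟨_, rfl⟩
  have en : x1 + x2 + x3 + x4 = 1 - m := by linarith
  have hm : 0 < m := by linarith
  have hn : 0 < 1 - m := by linarith
  obtain ⟨a, ea⟩ : ∃ a, (x7 + x8) / (x5 + x6 + x7 + x8) = a := ⟨_, rfl⟩
  obtain ⟨b, eb⟩ : ∃ b, (x3 + x4) / (x1 + x2 + x3 + x4) = b := ⟨_, rfl⟩
  have r1 := masses_eq (em ▸ hm) f1 c1 em ea
  have r0 := masses_eq (en ▸ hn) f0 c0 en eb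
  have ha : a ∈ unitInterval := ea ▸ em ▸ ⟨by positivity, by rw [div_le_one] <;> linarith⟩
  have hb : b ∈ unitInterval := eb ▸ en ▸ ⟨by positivity, by rw [div_le_one] <;> linarith⟩
  rw [em, div_eq_iff hm.ne'] at ea
  rw [en, div_eq_iff hn.ne'] at eb
  refine ⟨⟨m, hm.le, by linarith⟩, ⟨a, ha⟩, ⟨b, hb⟩, ⟨?_, ?_, ?_⟩, r1, r0⟩ <;>
    simp only <;> linarith

/-- The contribution to the loss of a signal pair that has probability `x` together with state `1`
and `y` together with state `0`, when action `1` is taken with probability `v`. If the pair has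
probability `0`, the benchmark is a junk value, but both sides vanish. -/
theorem benchmark_term {x y : ℝ} (hx : 0 ≤ x) (hy : 0 ≤ y) (v : ℝ) :
    y * ((if phi (x / (y + x)) = 0 then 1 else 0) - (1 - v)) +
      x * ((if phi (x / (y + x)) = 1 then 1 else 0) - v) = max x y - v * x - (1 - v) * y := by
  rcases eq_or_lt_of_le (add_nonneg hy hx) with h | h
  · obtain rfl : x = 0 := by linarith
    obtain rfl : y = 0 := by linarith
    simp
  · by_cases hxy : y ≤ x
    · have : phi (x / (y + x)) = 1 := by
        rw [phi_eq_one]; rw [div_le_div_iff₀ two_pos h]; linarith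
      simp [this, max_eq_left hxy]; ring
    · push Not at hxy
      have : phi (x / (y + x)) = 0 := by
        rw [phi_eq_zero]; rw [div_lt_div_iff₀ h two_pos]; linarith
      simp [this, max_eq_right hxy.le]; ring

theorem Admissible.recommendation_H (h : Admissible m a b) (i : Fin 2) :
    recommendation (ciStructure m a b) i .H = 1 := phi_eq_one (h.half_le_posterior_H i)

theorem Admissible.recommendation_L (h : Admissible m a b) (i : Fin 2) :
    recommendation (ciStructure m a b) i .L = 0 := phi_eq_zero (h.posterior_L_lt_half i)

theorem Admissible.prediction_H (h : Admissible m a b) (i : Fin 2) :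
    prediction (ciStructure m a b) i .H =
      1 - (m * a * (1 - a) + (1 - m) * b * (1 - b)) / (m * a + (1 - m) * b) := by
  have := h.probH_pos.ne'
  rw [one_sub_div this]
  fin_cases i <;>
  simp [prediction, condProb, prob, sum_outcome, signal, other, h.recommendation_H,
    h.recommendation_L] <;> simp [ciStructure] <;> congr 1 <;> ring

theorem Admissible.prediction_L (h : Admissible m a b) (i : Fin 2) :
    prediction (ciStructure m a b) i .L =
      (m * a * (1 - a) + (1 - m) * b * (1 - b)) / (m * (1 - a) + (1 - m) * (1 - b)) := by
  fin_cases i <;>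
  simp [prediction, condProb, prob, sum_outcome, signal, other, h.recommendation_H,
    h.recommendation_L] <;> simp [ciStructure] <;> congr 1 <;> ring

theorem ciStructure_benchmark (s t : Signal) :
    benchmark (ciStructure m a b) s t = phi ((ciStructure m a b).1 (1, s, t) /
      ((ciStructure m a b).1 (0, s, t) + (ciStructure m a b).1 (1, s, t))) := by
  cases s <;> cases t <;> simp [benchmark, condProb, prob, sum_outcome, state, signal]

/-- The loss, signal pair by signal pair: `(H, H)`, `(L, L)`, `(H, L)`, `(L, H)`. -/
theorem Admissible.loss_eq (h : Admissible m a b) (f : Aggregator) {p q x y : ℝ}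
    (hp : ∀ i, prediction (ciStructure m a b) i .H = p)
    (hq : ∀ i, prediction (ciStructure m a b) i .L = q)
    (hx : x = m * a * (1 - a)) (hy : y = (1 - m) * b * (1 - b)) :
    loss f (ciStructure m a b) =
      (1 - f 1 1 p p) * (m * a * a - (1 - m) * b * b) +
      f 0 0 q q * ((1 - m) * (1 - b) * (1 - b) - m * (1 - a) * (1 - a)) +
      (max x y - f 1 0 p q * x - (1 - f 1 0 p q) * y) +
      (max x y - f 0 1 q p * x - (1 - f 0 1 q p) * y) := by
  have a0 := a.2.1; have a1 := a.2.2; have b0 := b.2.1; have b1 := b.2.2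
  have m0 := m.2.1; have m1 := m.2.2; have hab := h.lt.le
  have hhigh := h.high
  have hlow := h.low
  have hx0 : 0 ≤ x := hx ▸ mul_nonneg (mul_nonneg m0 a0) (by linarith)
  have hy0 : 0 ≤ y := hy ▸ mul_nonneg (mul_nonneg (by linarith) b0) (by linarith)
  have hH : ((1 - m) * b * b : ℝ) ≤ m * a * a :=
    mul_le_mul hhigh hab b0 (mul_nonneg m0 a0)
  have hL : (m * (1 - a) * (1 - a) : ℝ) ≤ (1 - m) * (1 - b) * (1 - b) :=
    mul_le_mul hlow.le (by linarith) (by linarith) (by nlinarith)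
  have tHH := benchmark_term (x := m * a * a) (y := (1 - m) * b * b)
    (mul_nonneg (mul_nonneg m0 a0) a0) (mul_nonneg (mul_nonneg (by linarith) b0) b0) (f 1 1 p p)
  have tLL := benchmark_term (x := m * (1 - a) * (1 - a)) (y := (1 - m) * (1 - b) * (1 - b))
    (mul_nonneg (mul_nonneg m0 (by linarith)) (by linarith))
    (mul_nonneg (mul_nonneg (by linarith) (by linarith)) (by linarith)) (f 0 0 q q)
  have tHL := benchmark_term hx0 hy0 (f 1 0 p q)
  have tLH := benchmark_term hx0 hy0 (f 0 1 q p)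
  rw [max_eq_left hH] at tHH
  rw [max_eq_right hL] at tLL
  have wHH0 : (ciStructure m a b).1 (0, .H, .H) = (1 - m) * b * b := by simp [ciStructure]
  have wHH1 : (ciStructure m a b).1 (1, .H, .H) = m * a * a := by simp [ciStructure]
  have wLL0 : (ciStructure m a b).1 (0, .L, .L) = (1 - m) * (1 - b) * (1 - b) := by
    simp [ciStructure]
  have wLL1 : (ciStructure m a b).1 (1, .L, .L) = m * (1 - a) * (1 - a) := by
    simp [ciStructure]
  have wHL0 : (ciStructure m a b).1 (0, .H, .L) = y := by simp [ciStructure, hy]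
  have wHL1 : (ciStructure m a b).1 (1, .H, .L) = x := by simp [ciStructure, hx]
  have wLH0 : (ciStructure m a b).1 (0, .L, .H) = y := by simp [ciStructure, hy]; ring
  have wLH1 : (ciStructure m a b).1 (1, .L, .H) = x := by simp [ciStructure, hx]; ring
  rw [loss, sum_outcome]
  simp only [state, signal, matchProb, ciStructure_benchmark, h.recommendation_H,
    h.recommendation_L, hp, hq, wHH0, wHH1, wLL0, wLL1, wHL0, wHL1, wLH0, wLH1, if_true,
    zero_ne_one, one_ne_zero, if_false]
  linarith

/-! ### The radial rule -/

/-- Exchanging the two states and the two signals turns the predictions `(p, q)` into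
`(1 - q, 1 - p)`, and the radial rule respects this symmetry. -/
theorem radialValue_mirror (p q : ℝ) : radialValue (1 - q) (1 - p) = 1 - radialValue p q := by
  have e1 : (1 - q) + (1 - p) < 0.98 ↔ 1.02 < p + q := by constructor <;> intro h <;> linarith
  have e2 : 1.02 < (1 - q) + (1 - p) ↔ p + q < 0.98 := by constructor <;> intro h <;> linarith
  unfold radialValue
  rw [if_congr e1 rfl (if_congr e2 rfl rfl)]
  split_ifs with h1 h2
  · linarith
  · rw [← min_sub_sub_left]
    congr 1 <;> ring
  · rw [← max_sub_sub_left]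
    congr 1 <;> ring
  · norm_num

/-- The squared distance from the predictions `(1 - s / h, s / (1 - h))` to the centre
`(0.6, 0.4)` of the radial rule. -/
noncomputable def radius (h s : ℝ) : ℝ := (0.4 - s / h) ^ 2 + (0.4 - s / (1 - h)) ^ 2

theorem radius_nonneg (h s : ℝ) : 0 ≤ radius h s := by unfold radius; positivity

theorem add_predictions_eq {h s : ℝ} (h0 : 0 < h) (h1 : h < 1) :
    (1 - s / h) + s / (1 - h) = 1 - s * (1 - 2 * h) / (h * (1 - h)) := by
  have : 1 - h ≠ 0 := by linarith
  field_simp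
  ring

/-- In the band where the rule mixes evenly, the loss `t` is bounded by two functions of `h`, one
decreasing and one increasing, that cross at `h = 49 / 101`. -/
theorem band_bound {h t : ℝ} (h0 : 0 < h) (h1 : h < 1) (ht : t * (1 + h) ≤ h * (1 - h))
    (hs : t * (1 - 2 * h) ≤ 0.02 * (h * (1 - h))) : t ≤ 1274 / 7575 := by
  by_contra! hc
  rcases le_total h (49 / 101) with hh | hh <;> nlinarith

/-- One prediction's part of `loss_le_of_sub`, in units of the signal's probability. -/
theorem mul_half_sub_sq_le {u v w : ℝ} (hv : 0 ≤ v) (hvu : v ≤ u) (huw : u ≤ w) (hw : w ≤ 1 / 2) :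
    (u - v) * (1 / 2 - 2 * (0.4 - (u + v)) ^ 2) ≤ w * (1 / 2 - 2 * (0.4 - w) ^ 2) := by
  have h1 : 0 ≤ v * (0.18 + 1.6 * v + 2 * u ^ 2 - 2 * v ^ 2 - 2 * u * v) :=
    mul_nonneg hv (by nlinarith)
  have h2 : 0 ≤ (w - u) * (0.18 + 1.6 * (w + u) - 2 * (w ^ 2 + w * u + u ^ 2)) :=
    mul_nonneg (by linarith) (by nlinarith)
  linarith

/-- One prediction's part of `loss_le_of_add`, in units of the signal's probability. -/
theorem mul_half_add_sq_le {u v w : ℝ} (hv : 0 ≤ v) (hvu : v ≤ u) (huw : u ≤ w) (hw : w ≤ 1 / 2) :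
    (u - v) * (1 / 2 + 2 * (0.4 - (u + v)) ^ 2) ≤ w * (1 / 2 + 2 * (0.4 - w) ^ 2) := by
  have h1 : 0 ≤ v * (0.82 - 1.6 * v - 2 * u ^ 2 + 2 * v ^ 2 + 2 * u * v) :=
    mul_nonneg hv (by nlinarith [sq_nonneg (v - 0.4 + u / 2)])
  have h2 : 0 ≤ (w - u) * (0.82 - 1.6 * (w + u) + 2 * (w ^ 2 + w * u + u ^ 2)) :=
    mul_nonneg (by linarith) (by nlinarith [sq_nonneg (w + u - 0.5), sq_nonneg (w - u)])
  linarith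

/-- Splitting a loss with radius term into a part for each of the two predictions. -/
theorem mul_radius_eq {h t s : ℝ} (h0 : 0 < h) (h1 : h < 1) (c : ℝ) :
    t * (1 + c * radius h s) =
      h * (t / h * (1 / 2 + c * (0.4 - s / h) ^ 2)) +
      (1 - h) * (t / (1 - h) * (1 / 2 + c * (0.4 - s / (1 - h)) ^ 2)) := by
  have h2 : 1 - h ≠ 0 := by linarith
  have e1 : h * (t / h) = t := by field_simp
  have e2 : (1 - h) * (t / (1 - h)) = t := by field_simp
  rw [← mul_assoc, ← mul_assoc, e1, e2, radius]
  ring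

/-- Lowering `y` to `0` and raising `x` to `z` raises the loss where the rule leans to the
benchmark action. -/
theorem loss_le_of_sub {h x y z : ℝ} (h0 : 0 < h) (h1 : h < 1) (hy : 0 ≤ y) (hyx : y ≤ x)
    (hxz : x ≤ z) (hz : z ≤ h / 2) (hz' : z ≤ (1 - h) / 2) :
    (x - y) * (1 - 2 * radius h (x + y)) ≤ z * (1 - 2 * radius h z) := by
  have h2 : 0 < 1 - h := by linarith
  have e1 := mul_radius_eq (t := x - y) (s := x + y) h0 h1 (-2)
  have e2 := mul_radius_eq (t := z) (s := z) h0 h1 (-2)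
  have k1 := mul_half_sub_sq_le (u := x / h) (v := y / h) (w := z / h) (by positivity) (by gcongr)
    (by gcongr) (by rw [div_le_iff₀ h0]; linarith)
  have k2 := mul_half_sub_sq_le (u := x / (1 - h)) (v := y / (1 - h)) (w := z / (1 - h))
    (by positivity) (by gcongr) (by gcongr) (by rw [div_le_iff₀ h2]; linarith)
  rw [← sub_div, ← add_div] at k1 k2
  linarith [mul_le_mul_of_nonneg_left k1 h0.le, mul_le_mul_of_nonneg_left k2 h2.le]

/-- The same where the rule leans away from the benchmark action. -/
theorem loss_le_of_add {h x y z : ℝ} (h0 : 0 < h) (h1 : h < 1) (hy : 0 ≤ y) (hyx : y ≤ x)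
    (hxz : x ≤ z) (hz : z ≤ h / 2) (hz' : z ≤ (1 - h) / 2) :
    (x - y) * (1 + 2 * radius h (x + y)) ≤ z * (1 + 2 * radius h z) := by
  have h2 : 0 < 1 - h := by linarith
  have e1 := mul_radius_eq (t := x - y) (s := x + y) h0 h1 2
  have e2 := mul_radius_eq (t := z) (s := z) h0 h1 2
  have k1 := mul_half_add_sq_le (u := x / h) (v := y / h) (w := z / h) (by positivity) (by gcongr)
    (by gcongr) (by rw [div_le_iff₀ h0]; linarith)
  have k2 := mul_half_add_sq_le (u := x / (1 - h)) (v := y / (1 - h)) (w := z / (1 - h))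
    (by positivity) (by gcongr) (by gcongr) (by rw [div_le_iff₀ h2]; linarith)
  rw [← sub_div, ← add_div] at k1 k2
  linarith [mul_le_mul_of_nonneg_left k1 h0.le, mul_le_mul_of_nonneg_left k2 h2.le]

/-- The extreme loss `h (1 - h) / (1 + h)` and its predictions in terms of `r = 1 / (1 + h)`. -/
theorem extreme_eq {h r : ℝ} (h0 : 0 < h) (h1 : h < 1) (hr : r = 1 / (1 + h)) :
    h * (1 - h) / (1 + h) = (3 * r - 2 * r ^ 2 - 1) / r ∧
    radius h (h * (1 - h) / (1 + h)) = (0.4 - (2 * r - 1)) ^ 2 + (1 - r - 0.4) ^ 2 := by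
  have h2 : 1 - h ≠ 0 := by linarith
  have e1 : h * (1 - h) / (1 + h) / h = 2 * r - 1 := by rw [hr]; field_simp; ring
  have e2 : h * (1 - h) / (1 + h) / (1 - h) = 1 - r := by rw [hr]; field_simp; ring
  refine ⟨by rw [hr]; field_simp; ring, ?_⟩
  rw [radius, e1, e2]
  ring

theorem extreme_sub_le {h : ℝ} (h0 : 0 < h) (h1 : h < 1) :
    h * (1 - h) / (1 + h) * (1 - 2 * radius h (h * (1 - h) / (1 + h))) ≤ 1274 / 7575 := by
  obtain ⟨r, hr⟩ : ∃ r, r = 1 / (1 + h) := ⟨_, rfl⟩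
  have r0 : 0 < r := by rw [hr]; positivity
  have r1 : r ≤ 1 := by rw [hr, div_le_one] <;> linarith
  have r2 : 1 / 2 ≤ r := by rw [hr, div_le_div_iff₀] <;> linarith
  obtain ⟨e1, e2⟩ := extreme_eq h0 h1 hr
  rw [e2, e1, div_mul_eq_mul_div, div_le_iff₀ r0]
  -- the maximum of the left side is attained near `r = 0.697`
  nlinarith [mul_nonneg (mul_nonneg (sub_nonneg.2 r2) (sub_nonneg.2 r1)) (sq_nonneg (r - 0.697)),
    mul_nonneg (sub_nonneg.2 r2) (sq_nonneg (r - 0.697)),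
    mul_nonneg (sub_nonneg.2 r1) (sq_nonneg (r - 0.697))]

theorem extreme_add_le {h : ℝ} (h0 : 17 / 33 ≤ h) (h1 : h < 1) :
    h * (1 - h) / (1 + h) * (1 + 2 * radius h (h * (1 - h) / (1 + h))) ≤ 1274 / 7575 := by
  obtain ⟨r, hr⟩ : ∃ r, r = 1 / (1 + h) := ⟨_, rfl⟩
  have r0 : 0 < r := by rw [hr]; positivity
  have r1 : r ≤ 0.66 := by rw [hr, div_le_iff₀] <;> linarith
  have r2 : 1 / 2 ≤ r := by rw [hr, div_le_div_iff₀] <;> linarith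
  obtain ⟨e1, e2⟩ := extreme_eq (by linarith) h1 hr
  rw [e2, e1, div_mul_eq_mul_div, div_le_iff₀ r0]
  nlinarith [mul_nonneg (sub_nonneg.2 r2) (sub_nonneg.2 r1),
    mul_nonneg (sub_nonneg.2 r1) (sq_nonneg (r - 0.5)),
    mul_nonneg (mul_nonneg (sub_nonneg.2 r2) (sub_nonneg.2 r1)) (sq_nonneg (r - 0.5)),
    mul_nonneg (mul_nonneg (sub_nonneg.2 r2) (sub_nonneg.2 r1)) (sq_nonneg (r - 0.66))]

/-- Just above `h = 1 / 2` the condition `p + q > 1.02` bounds `x - y`. -/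
theorem sub_le_of_add_predictions {h x y : ℝ} (h0 : 1 / 2 < h) (h1 : h ≤ 17 / 33)
    (hx : x * (1 + h) ≤ h * (1 - h))
    (hs : 0.02 * (h * (1 - h)) ≤ (x + y) * (2 * h - 1)) : x - y ≤ 136 / 825 := by
  have k : (x - y) * ((1 + h) * (2 * h - 1)) ≤ h * (1 - h) * (3.98 * h - 2.02) := by
    nlinarith
  have k2 : h * (1 - h) * (3.98 * h - 2.02) ≤ 136 / 825 * ((1 + h) * (2 * h - 1)) := by
    nlinarith [mul_nonneg (sub_nonneg.2 h0.le) (sub_nonneg.2 h1)]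
  exact le_of_mul_le_mul_right (k.trans k2) (by nlinarith)

/-- The bound `136 / 825` of `sub_le_of_add_predictions` is the extreme value
`h (1 - h) / (1 + h)` at `h = 17 / 33`, and the loss it gives is below `1274 / 7575`. -/
theorem low_add_le {h : ℝ} (h0 : 1 / 2 < h) (h1 : h ≤ 17 / 33) :
    136 / 825 * (1 + 2 * radius h (136 / 825)) ≤ 1274 / 7575 := by
  obtain ⟨d, hd⟩ : ∃ d, d = 17 / 33 - h := ⟨_, rfl⟩
  -- linear bounds with nearly the tangent slopes at `h = 17 / 33`, where the predictions are
  -- `(0.68, 0.34)`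
  have c1 : 0.32 + 0.62 * d ≤ 136 / 825 / h := by
    rw [le_div_iff₀ (by linarith)]; nlinarith
  have c2 : 136 / 825 / h ≤ 0.4 := by
    rw [div_le_iff₀ (by linarith)]; linarith
  have c3 : 0.34 - 0.71 * d ≤ 136 / 825 / (1 - h) := by
    rw [le_div_iff₀ (by linarith)]; nlinarith
  have c4 : 136 / 825 / (1 - h) ≤ 0.4 := by
    rw [div_le_iff₀ (by linarith)]; linarith
  have q1 : (0.4 - 136 / 825 / h) ^ 2 ≤ (0.08 - 0.62 * d) ^ 2 :=
    pow_le_pow_left₀ (by linarith) (by linarith) 2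
  have q2 : (0.4 - 136 / 825 / (1 - h)) ^ 2 ≤ (0.06 + 0.71 * d) ^ 2 :=
    pow_le_pow_left₀ (by linarith) (by linarith) 2
  have : radius h (136 / 825) ≤ 0.0101 := by
    unfold radius
    nlinarith
  linarith

/-- The bound on the loss when the benchmark takes action `1` at disagreement: `h` is the
probability of the signal `H`, and `x`, `y` are the probabilities of the signals `(H, L)` together
with state `1` and with state `0`. -/
theorem radial_loss_le {h x y : ℝ} (h0 : 0 < h) (h1 : h < 1) (hy : 0 ≤ y) (hyx : y ≤ x)
    (hx : x * (1 + h) ≤ h * (1 - h)) :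
    2 * (1 - radialValue (1 - (x + y) / h) ((x + y) / (1 - h))) * (x - y) ≤ 1274 / 7575 := by
  have hp : 0 < h * (1 - h) := mul_pos h0 (by linarith)
  have hxX : x ≤ h * (1 - h) / (1 + h) := by rwa [le_div_iff₀ (by linarith)]
  have eR : (1 - (x + y) / h - 0.6) ^ 2 + ((x + y) / (1 - h) - 0.4) ^ 2 = radius h (x + y) := by
    rw [radius]; ring
  have hX2 : h * (1 - h) / (1 + h) ≤ (1 - h) / 2 := by
    rw [div_le_div_iff₀ (by linarith) two_pos]; nlinarith
  have hX1 (h3 : 1 / 3 ≤ h) : h * (1 - h) / (1 + h) ≤ h / 2 := by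
    rw [div_le_div_iff₀ (by linarith) two_pos]; nlinarith
  unfold radialValue
  split_ifs with c1 c2
  · rw [eR]
    rcases le_total (radius h (x + y) + 0.5) 1 with hc | hc
    · rw [min_eq_right hc]
      rcases le_total h (1 / 3) with h3 | h3
      · have : x ≤ 1 / 6 := by
          refine hxX.trans ?_
          rw [div_le_div_iff₀ (by linarith) (by norm_num)]
          nlinarith
        nlinarith [radius_nonneg h (x + y)]
      · have := loss_le_of_sub h0 h1 hy hyx hxX (hX1 h3) hX2
        linarith [extreme_sub_le h0 h1]
    · rw [min_eq_left hc]
      norm_num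
  · rw [add_predictions_eq h0 h1, lt_sub_comm, div_lt_iff₀ hp] at c2
    have hh : 1 / 2 < h := by
      by_contra! hh
      nlinarith [mul_nonneg (add_nonneg (hy.trans hyx) hy) (by linarith : 0 ≤ 1 - 2 * h)]
    have hle : 2 * (1 - max 0 (0.5 - (1 - (x + y) / h - 0.6) ^ 2 - ((x + y) / (1 - h) - 0.4) ^ 2)) *
        (x - y) ≤ (x - y) * (1 + 2 * radius h (x + y)) := by
      rw [mul_comm]
      refine mul_le_mul_of_nonneg_left ?_ (sub_nonneg.2 hyx)
      linarith [le_max_right 0 (0.5 - (1 - (x + y) / h - 0.6) ^ 2 - ((x + y) / (1 - h) - 0.4) ^ 2)]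
    refine hle.trans ?_
    rcases le_total h (17 / 33) with h3 | h3
    · have ht := sub_le_of_add_predictions (y := y) hh h3 hx (by linarith)
      -- since `x / h` and `x / (1 - h)` are at most `0.4`, the centre is farther at `x - y` than
      -- at `x + y`
      have hrad : radius h (x + y) ≤ radius h (x - y + 0) := by
        have k1 : x / h ≤ 0.4 := by rw [div_le_iff₀ h0]; nlinarith
        have k2 : x / (1 - h) ≤ 0.4 := by rw [div_le_iff₀ (by linarith)]; nlinarith
        have k3 : 0 ≤ y / h := by positivity
        have k4 : 0 ≤ y / (1 - h) := div_nonneg hy (by linarith)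
        unfold radius
        rw [add_zero, add_div, add_div, sub_div, sub_div]
        nlinarith
      have k := loss_le_of_add h0 h1 le_rfl (sub_nonneg.2 hyx) (y := 0) ht
        (by linarith) (by linarith)
      rw [sub_zero] at k
      exact (mul_le_mul_of_nonneg_left (by linarith) (sub_nonneg.2 hyx)).trans
        (k.trans (low_add_le hh h3))
    · exact (loss_le_of_add h0 h1 hy hyx hxX (hX1 (by linarith)) hX2).trans (extreme_add_le h3 h1)
  · rw [add_predictions_eq h0 h1, not_lt, le_sub_comm, div_le_iff₀ hp] at c1
    have : x - y ≤ 1274 / 7575 := by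
      rcases le_total h (1 / 2) with h3 | h3
      · exact band_bound h0 h1 (by nlinarith) (by nlinarith)
      · exact band_bound h0 h1 (by nlinarith) (by nlinarith)
    linarith

/-! ### The loss of the bipolar radial rule -/

theorem Admissible.bipolarRadial_loss_eq (h : Admissible m a b) {x y k : ℝ}
    (hx : x = m * a * (1 - a)) (hy : y = (1 - m) * b * (1 - b)) (hk : k = m * a + (1 - m) * b) :
    loss bipolarRadial (ciStructure m a b) =
      2 * (max x y - radialValue (1 - (x + y) / k) ((x + y) / (1 - k)) * x -
        (1 - radialValue (1 - (x + y) / k) ((x + y) / (1 - k))) * y) := by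
  have hk' : (m * (1 - a) + (1 - m) * (1 - b) : ℝ) = 1 - k := by rw [hk]; ring
  have hp := h.prediction_H
  have hq := h.prediction_L
  rw [hk', ← hx, ← hy] at hq
  rw [← hk, ← hx, ← hy] at hp
  rw [h.loss_eq bipolarRadial hp hq hx hy]
  simp [bipolarRadial]
  ring

theorem Admissible.bipolarRadial_loss_le (h : Admissible m a b) :
    loss bipolarRadial (ciStructure m a b) ≤ 1274 / 7575 := by
  obtain ⟨x, hx⟩ : ∃ x : ℝ, x = m * a * (1 - a) := ⟨_, rfl⟩
  obtain ⟨y, hy⟩ : ∃ y : ℝ, y = (1 - m) * b * (1 - b) := ⟨_, rfl⟩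
  obtain ⟨k, hk⟩ : ∃ k : ℝ, k = m * a + (1 - m) * b := ⟨_, rfl⟩
  rw [h.bipolarRadial_loss_eq hx hy hk]
  have a0 := a.2.1; have a1 := sub_nonneg.2 a.2.2; have b0 := b.2.1; have b1 := sub_nonneg.2 b.2.2
  have m0 := m.2.1; have m1 := sub_nonneg.2 m.2.2
  have k0 : 0 < k := hk ▸ h.probH_pos
  have k1 : k < 1 := by linarith [h.probL_pos]
  have hx0 : 0 ≤ x := hx ▸ mul_nonneg (mul_nonneg m0 a0) a1
  have hy0 : 0 ≤ y := hy ▸ mul_nonneg (mul_nonneg m1 b0) b1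
  rcases le_total y x with hyx | hxy
  · have hb : x * (1 + k) ≤ k * (1 - k) := by
      -- `ℙ(ω = 1, H) ≤ k` and `ℙ(ω = 1, L) ≤ (1 - k) / 2`
      have e1 : (m * a : ℝ) ≤ k := by rw [hk]; linarith [mul_nonneg m1 b0]
      have e2 : (m * (1 - a) : ℝ) ≤ (1 - k) / 2 := by rw [hk]; linarith [h.low]
      have f1 := mul_le_mul_of_nonneg_right e1 (mul_nonneg a1 (by linarith : 0 ≤ 1 - k))
      have f2 := mul_le_mul_of_nonneg_left e2 (mul_nonneg a0 k0.le)
      rw [hx]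
      linarith
    rw [max_eq_left hyx]
    linarith [radial_loss_le k0 k1 hy0 hyx hb]
  · have hb : y * (1 + (1 - k)) ≤ (1 - k) * (1 - (1 - k)) := by
      have e1 : ((1 - m) * (1 - b) : ℝ) ≤ 1 - k := by rw [hk]; linarith [mul_nonneg m0 a1]
      have e2 : ((1 - m) * b : ℝ) ≤ k / 2 := by rw [hk]; linarith [h.high]
      have f1 := mul_le_mul_of_nonneg_right e1 (mul_nonneg b0 k0.le)
      have f2 := mul_le_mul_of_nonneg_left e2 (mul_nonneg b1 (by linarith : 0 ≤ 1 - k))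
      rw [hy]
      linarith
    have := radial_loss_le (by linarith) (by linarith) hx0 hxy hb
    have e := radialValue_mirror (1 - (x + y) / k) ((x + y) / (1 - k))
    rw [sub_sub_cancel] at this e
    rw [add_comm y x, e] at this
    rw [max_eq_right hxy]
    linarith

/-- The worst case: state `1` always produces `H`, and `b_H = 1/2`. -/
theorem exists_bipolarRadial_loss_eq :
    ∃ π ∈ homogeneousNonDegenerateCI, loss bipolarRadial π = 1274 / 7575 := by
  have hab : Admissible ⟨26 / 101, by norm_num, by norm_num⟩ 1
      ⟨26 / 75, by norm_num, by norm_num⟩ := by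
    constructor <;> norm_num
  refine ⟨_, hab.mem, ?_⟩
  rw [hab.bipolarRadial_loss_eq (x := 0) (y := 1274 / 7575) (k := 52 / 101) (by norm_num)
    (by norm_num) (by norm_num)]
  -- the predictions add up to exactly `1.02`, so the rule still mixes evenly
  norm_num [radialValue]

theorem bipolarRadial_isGreatest :
    IsGreatest (loss bipolarRadial '' homogeneousNonDegenerateCI) (1274 / 7575) := by
  refine ⟨exists_bipolarRadial_loss_eq, ?_⟩
  rintro _ ⟨π, hπ, rfl⟩
  obtain ⟨m, a, b, hab, rfl⟩ := exists_ciStructure_eq hπ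
  exact hab.bipolarRadial_loss_le

/-! ### Aggregators without second-order information -/

theorem loss_le_one (f : Aggregator) (π : InfoStructure) : loss f π ≤ 1 := by
  calc loss f π ≤ ∑ x, π.1 x := by
        refine Finset.sum_le_sum fun x _ => mul_le_of_le_one_right (π.2.1 x) ?_
        have hq (q : unitInterval) (ω : Fin 2) : 0 ≤ matchProb q ω := by
          unfold matchProb
          split_ifs
          · exact q.2.1
          · exact sub_nonneg.2 q.2.2
        exact (sub_le_self _ (hq _ _)).trans (by split_ifs <;> norm_num)
    _ = 1 := π.2.2

theorem loss_le_regret (f : Aggregator) {P : Set InfoStructure} {π : InfoStructure} (hπ : π ∈ P) :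
    loss f π ≤ regret P f :=
  le_csSup ⟨1, by rintro _ ⟨ρ, -, rfl⟩; exact loss_le_one f ρ⟩ ⟨π, hπ, rfl⟩

/-- Departing from unanimous experts never lowers the loss of a first-order aggregator, so its regret
is at least the part of the loss that comes from disagreement. -/
theorem Admissible.le_firstOrder_regret (h : Admissible m a b) (g : FirstOrderAggregator) {x y : ℝ}
    (hx : x = m * a * (1 - a)) (hy : y = (1 - m) * b * (1 - b)) :
    2 * max x y - (g 1 0 + g 0 1) * x - (2 - (g 1 0 + g 0 1)) * y ≤
      regret homogeneousNonDegenerateCI g.toAggregator := by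
  refine le_trans ?_ (loss_le_regret _ h.mem)
  rw [h.loss_eq g.toAggregator h.prediction_H h.prediction_L hx hy]
  have a0 := a.2.1; have a1 := sub_nonneg.2 a.2.2; have b0 := b.2.1; have b1 := sub_nonneg.2 b.2.2
  have m0 := m.2.1; have m1 := sub_nonneg.2 m.2.2
  have hab := h.lt.le
  have hH : ((1 - m) * b * b : ℝ) ≤ m * a * a :=
    mul_le_mul h.high hab b0 (mul_nonneg m0 a0)
  have hL : (m * (1 - a) * (1 - a) : ℝ) ≤ (1 - m) * (1 - b) * (1 - b) :=
    mul_le_mul h.low.le (by linarith) (by linarith) (mul_nonneg m1 b1)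
  have k1 := mul_nonneg (sub_nonneg.2 (g 1 1).2.2) (sub_nonneg.2 hH)
  have k2 := mul_nonneg (g 0 0).2.1 (sub_nonneg.2 hL)
  simp only [FirstOrderAggregator.toAggregator]
  linarith

theorem le_firstOrder_regret (g : FirstOrderAggregator) :
    3 - 2 * √2 ≤ regret homogeneousNonDegenerateCI g.toAggregator := by
  have s2 : √2 * √2 = 2 := Real.mul_self_sqrt zero_le_two
  have s0 : 1.4 < √2 := Real.lt_sqrt_of_sq_lt (by norm_num)
  have s1 : √2 < 1.5 := by nlinarith
  rcases le_total 1 ((g 1 0 : ℝ) + g 0 1) with hg | hg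
  · -- `H` is certain in state `1`, and `b_H = 1 / 2`
    have hab : Admissible ⟨1 - √2 / 2, by linarith, by linarith⟩ 1
        ⟨√2 - 1, by linarith, by linarith⟩ := by
      constructor <;> simp <;> nlinarith
    have := hab.le_firstOrder_regret g (x := 0) (y := 3 - 2 * √2) (by simp)
      (by simp only; linear_combination (√2 / 2 - 3 / 2) * s2)
    rw [max_eq_right (by linarith)] at this
    nlinarith
  · -- `L` is certain in state `0`, and `b_L = 1 / 2` in the limit `m → √2 / 2`
    have key (ε : ℝ) (h0 : 0 < ε) (h1 : ε < 1 / 2) :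
        3 - 2 * √2 - ε ≤ regret homogeneousNonDegenerateCI g.toAggregator := by
      have hab : Admissible ⟨√2 / 2 - ε, by linarith, by linarith⟩
          ⟨2 - √2, by linarith, by linarith⟩ 0 := by
        constructor <;> simp <;> nlinarith
      have := hab.le_firstOrder_regret g (x := (√2 / 2 - ε) * (3 * √2 - 4)) (y := 0)
        (by simp only; linear_combination (√2 / 2 - ε) * s2) (by simp)
      have hx : (√2 / 2 - ε) * (3 * √2 - 4) = 3 - 2 * √2 - ε * (3 * √2 - 4) := by
        linear_combination 3 / 2 * s2
      have hx0 : 0 ≤ (√2 / 2 - ε) * (3 * √2 - 4) := mul_nonneg (by linarith) (by linarith)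
      rw [max_eq_left hx0] at this
      nlinarith
    by_contra! hc
    obtain ⟨ε, e0, e1⟩ := exists_between (lt_min (sub_pos.2 hc) (by norm_num : (0 : ℝ) < 1 / 2))
    have := key ε e0 (e1.trans_le (min_le_right _ _))
    linarith [e1.trans_le (min_le_left _ _)]

end DecisionAggregation

theorem mainTheorem12 :
    IsGreatest
      (DecisionAggregation.loss DecisionAggregation.bipolarRadial ''
        DecisionAggregation.homogeneousNonDegenerateCI)
      (DecisionAggregation.regret DecisionAggregation.homogeneousNonDegenerateCI
        DecisionAggregation.bipolarRadial) ∧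
    |DecisionAggregation.regret DecisionAggregation.homogeneousNonDegenerateCI
        DecisionAggregation.bipolarRadial - 0.1682| ≤ 0.00005 ∧
    DecisionAggregation.regret DecisionAggregation.homogeneousNonDegenerateCI
        DecisionAggregation.bipolarRadial < 3 - 2 * Real.sqrt 2 ∧
    ∀ g : DecisionAggregation.FirstOrderAggregator,
      3 - 2 * Real.sqrt 2 ≤
        DecisionAggregation.regret DecisionAggregation.homogeneousNonDegenerateCI
          g.toAggregator := by
  have h := DecisionAggregation.bipolarRadial_isGreatest
  have e : DecisionAggregation.regret DecisionAggregation.homogeneousNonDegenerateCI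
      DecisionAggregation.bipolarRadial = 1274 / 7575 := h.csSup_eq
  rw [e]
  refine ⟨h, ?_, ?_, DecisionAggregation.le_firstOrder_regret⟩
  · rw [abs_le]
    constructor <;> norm_num
  · have : √2 < 1.415 := by
      rw [Real.sqrt_lt' (by norm_num)]
      norm_num
    norm_num at this ⊢
    linarith
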